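/- Let $d\ge 1$ be an integer and let $Q=[0,1)^d\subset\mathbb{R}^d$ be the half-open unit cube. For $t\in\mathbb{R}^d$ let $e_t(x)=\exp(2\pi i\, t\cdot x)$, where $t\cdot x=t_1x_1+\cdots+t_dx_d$. Let $T$ be a subset of $\mathbb{R}^d$. Then the family of exponentials $(e_t)_{t\in T}$ is an orthonormal basis of the complex Hilbert space $L^2(Q)$ (with respect to Lebesgue measure, with inner product $\langle f,g\rangle=\int_Q f\,\overline{g}$) if and only if the translates $Q+t$, $t\in T$, tile $\mathbb{R}^d$, that is, every $x\in\mathbb{R}^d$ can be written uniquely as $x=q+t$ with $q\in Q$ and $t\in T$. -/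

import Mathlib

open MeasureTheory

noncomputable section

/-- The half-open unit cube `[0,1)^d` in `d`-dimensional Euclidean space. -/
def unitCube (d : ℕ) : Set (EuclideanSpace ℝ (Fin d)) :=
  {x | ∀ j, 0 ≤ x j ∧ x j < 1}

/-- The exponential `e_t(x) = exp(2πi t·x)`, where `t·x = t_1 x_1 + ⋯ + t_d x_d`. -/
def expFun {d : ℕ} (t x : EuclideanSpace ℝ (Fin d)) : ℂ :=
  Complex.exp (2 * Real.pi * Complex.I * ((∑ j, t j * x j : ℝ) : ℂ))

/-- `T` is a tiling set for the unit cube: each point of `ℝ^d` can be written uniquely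
as `q + t` with `q` in the unit cube and `t ∈ T`. -/
def IsTilingSet {d : ℕ} (T : Set (EuclideanSpace ℝ (Fin d))) : Prop :=
  ∀ x : EuclideanSpace ℝ (Fin d),
    ∃! p : EuclideanSpace ℝ (Fin d) × EuclideanSpace ℝ (Fin d),
      p.1 ∈ unitCube d ∧ p.2 ∈ T ∧ x = p.1 + p.2

/-- `T` is a spectrum for the unit cube: the family of (the `L²`-classes of) the exponentials
`e_t`, `t ∈ T`, is an orthonormal basis (Hilbert basis) of the complex Hilbert space
`L²([0,1)^d)` with respect to Lebesgue measure. -/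
def IsSpectrum {d : ℕ} (T : Set (EuclideanSpace ℝ (Fin d))) : Prop :=
  ∃ b : HilbertBasis T ℂ (Lp ℂ 2 (volume.restrict (unitCube d))),
    ∀ t : T, (b t : EuclideanSpace ℝ (Fin d) → ℂ)
      =ᵐ[volume.restrict (unitCube d)] expFun (t : EuclideanSpace ℝ (Fin d))

end

open scoped Topology ENNReal ComplexConjugate

/-! Let `F` be the Fourier transform of the indicator of `Q`. It is a product of one-dimensional
integrals, each vanishing exactly at the nonzero integers, so orthonormality of `(e_t)` means that
distinct elements of `T` differ by a nonzero integer in some coordinate (`orthonormal_expLp_iff`).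
Tilings have this property by Keller's theorem (`IsCubeTiling.exists_int_sub`).

Under this separation the translates are disjoint, and Bessel's inequality for `e_{-x}` reads `∑
|F(x+t)|² ≤ 1`. Integrated over `Q`, the left side becomes the integral of `|F|²` over the union `U`
of the translates; the case `T = ℤ^d` shows that the integral over the whole space is `1`.

For a spectrum, Bessel is an equality, so `U` carries all of `|F|²`. A point missed by `U` would
leave an open set off `U` on which `F ≠ 0`, a contradiction. For a tiling, the Bessel sum is at most
`1` with mean `1` over every translate of `Q`, hence equals `1` almost everywhere. Any `f`
orthogonal to all `e_t` is then orthogonal to `e_{-x}` for almost every `x`, by continuity for every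
`x`, and completeness of `ℤ^d` gives `f = 0`. -/

/-- The translates of the half-open unit cube by the vectors `τ i` cover each point exactly once,
counted with the multiplicity of the family. -/
def IsCubeTiling {J ι : Type*} (τ : ι → J → ℝ) : Prop :=
  ∀ x : J → ℝ, ∃! i, ∀ j, τ i j ≤ x j ∧ x j < τ i j + 1

/-! ### Keller's theorem on cube tilings -/

namespace IsCubeTiling

variable {J ι : Type*} {τ : ι → J → ℝ}

/-- Two cubes of a tiling met by a common line in direction `k` have `k`-th coordinates that are
congruent modulo `1`. -/
theorem exists_int_sub_of_line [DecidableEq J] (h : IsCubeTiling τ) {x : J → ℝ} {k : J} {u v : ℝ}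
    {i i' : ι}
    (hi : ∀ j, τ i j ≤ Function.update x k u j ∧ Function.update x k u j < τ i j + 1)
    (hi' : ∀ j, τ i' j ≤ Function.update x k v j ∧ Function.update x k v j < τ i' j + 1) :
    ∃ n : ℤ, τ i' k - τ i k = n := by
  wlog huv : u ≤ v generalizing u v i i'
  · obtain ⟨n, hn⟩ := this hi' hi (le_of_not_ge huv)
    exact ⟨-n, by push_cast; linarith⟩
  have move : ∀ {w w' : ℝ} {a : ι},
      (∀ j, τ a j ≤ Function.update x k w j ∧ Function.update x k w j < τ a j + 1) →
      τ a k ≤ w' → w' < τ a k + 1 →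
      ∀ j, τ a j ≤ Function.update x k w' j ∧ Function.update x k w' j < τ a j + 1 := by
    intro w w' a ha h1 h2 j
    rcases eq_or_ne j k with rfl | hj
    · simpa using ⟨h1, h2⟩
    · simpa [hj] using ha j
  -- Walking along the line, the next cube must start exactly where the last one ends: starting
  -- earlier, it would overlap that cube.
  have step : ∀ n : ℕ, ∃ a : ι, τ a k = τ i k + n ∧
      ∀ j, τ a j ≤ Function.update x k (τ i k + n) j ∧
        Function.update x k (τ i k + n) j < τ a j + 1 := by
    intro n
    induction n with
    | zero => exact ⟨i, by simp, by simpa using move hi le_rfl (by linarith)⟩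
    | succ n ih =>
      obtain ⟨a, ha, hca⟩ := ih
      obtain ⟨b, hb, -⟩ := h (Function.update x k (τ i k + (n + 1 : ℕ)))
      refine ⟨b, ?_, hb⟩
      have hbk := hb k
      simp only [Function.update_self] at hbk
      push_cast at hbk ⊢
      by_contra hne
      have hlt : τ b k < τ i k + (n + 1) := lt_of_le_of_ne hbk.1 hne
      have e : a = b := (h (Function.update x k (τ b k))).unique
        (move hca (by linarith) (by linarith)) (move hb le_rfl (by linarith))
      rw [← e] at hbk
      linarith
  have hik := hi k
  have hi'k := hi' k
  simp only [Function.update_self] at hik hi'k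
  have h0 : 0 ≤ v - τ i k := by linarith
  obtain ⟨a, ha, hca⟩ := step ⌊v - τ i k⌋₊
  have f1 := Nat.floor_le h0
  have f2 := Nat.lt_floor_add_one (v - τ i k)
  have e : a = i' := (h (Function.update x k v)).unique
    (move hca (by linarith) (by linarith)) hi'
  exact ⟨⌊v - τ i k⌋₊, by rw [← e, ha]; push_cast; ring⟩

open Classical in
/-- Shifting, in direction `k`, all the cubes whose `k`-th coordinate lies in a given class
modulo `1` preserves tilings. -/
theorem shift (h : IsCubeTiling τ) (k : J) (a s : ℝ) :
    IsCubeTiling fun i => if ∃ n : ℤ, τ i k - a = n then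
      Function.update (τ i) k (τ i k + s) else τ i := by
  intro x
  have key : ∀ i, (∃ n : ℤ, τ i k - a = n) →
      ((∀ j, Function.update (τ i) k (τ i k + s) j ≤ x j ∧
          x j < Function.update (τ i) k (τ i k + s) j + 1) ↔
        ∀ j, τ i j ≤ Function.update x k (x k - s) j ∧
          Function.update x k (x k - s) j < τ i j + 1) := by
    intro i _
    refine forall_congr' fun j => ?_
    rcases eq_or_ne j k with rfl | hj
    · simp only [Function.update_self]
      constructor <;> rintro ⟨h1, h2⟩ <;> constructor <;> linarith
    · simp [hj]
  -- The cubes `p` over `x` and `q` over `x - s e_k` lie on one line, so both move or neither does;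
  -- accordingly `q` or `p` covers `x` afterwards.
  obtain ⟨p, hp, hpu⟩ := h x
  obtain ⟨q, hq, hqu⟩ := h (Function.update x k (x k - s))
  have hp' : ∀ j, τ p j ≤ Function.update x k (x k) j ∧
      Function.update x k (x k) j < τ p j + 1 := by simpa using hp
  obtain ⟨m, hm⟩ := h.exists_int_sub_of_line hp' hq
  by_cases hc : ∃ n : ℤ, τ p k - a = n
  · have hcq : ∃ n : ℤ, τ q k - a = n := by
      obtain ⟨n, hn⟩ := hc
      exact ⟨m + n, by push_cast; linarith⟩
    refine ⟨q, ?_, ?_⟩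
    · simp only [if_pos hcq]
      exact (key q hcq).2 hq
    · intro i hi
      by_cases hci : ∃ n : ℤ, τ i k - a = n
      · simp only [if_pos hci] at hi
        exact hqu i ((key i hci).1 hi)
      · simp only [if_neg hci] at hi
        exact absurd (hpu i hi ▸ hc) hci
  · have hcq : ¬ ∃ n : ℤ, τ q k - a = n := by
      rintro ⟨n, hn⟩
      exact hc ⟨n - m, by push_cast; linarith⟩
    refine ⟨p, ?_, ?_⟩
    · simp only [if_neg hc]
      exact hp
    · intro i hi
      by_cases hci : ∃ n : ℤ, τ i k - a = n
      · simp only [if_pos hci] at hi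
        exact absurd (hqu i ((key i hci).1 hi) ▸ hci) hcq
      · simp only [if_neg hci] at hi
        exact hpu i hi

/-- **Keller's theorem**: in a tiling by unit cubes, two distinct cubes differ by a nonzero integer
in some coordinate. -/
theorem exists_int_sub [Fintype J] (h : IsCubeTiling τ) {p q : ι} (hpq : p ≠ q) :
    ∃ j, ∃ n : ℤ, n ≠ 0 ∧ τ p j - τ q j = n := by
  classical
  by_contra! hno
  -- With no nonzero integer difference, shifts can align `p` and `q` one coordinate at a time until
  -- the two cubes coincide.
  suffices H : ∀ S : Finset J, ∃ σ : ι → J → ℝ, IsCubeTiling σ ∧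
      (∀ j ∈ S, σ p j = σ q j) ∧ ∀ j ∉ S, σ p j = τ p j ∧ σ q j = τ q j by
    obtain ⟨σ, hσ, he, -⟩ := H Finset.univ
    refine hpq ((hσ (σ p)).unique (fun j => ⟨le_rfl, by linarith⟩) fun j => ?_)
    rw [he j (Finset.mem_univ j)]
    exact ⟨le_rfl, by linarith⟩
  intro S
  induction S using Finset.induction_on with
  | empty => exact ⟨τ, h, by simp, by simp⟩
  | insert k S hk ih =>
    obtain ⟨σ, hσ, he, hn⟩ := ih
    obtain ⟨hpk, hqk⟩ := hn k hk
    by_cases hint : ∃ n : ℤ, τ p k - τ q k = n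
    · obtain ⟨n, hn'⟩ := hint
      have hn0 : n = 0 := by
        by_contra h0
        exact hno k n h0 hn'
      refine ⟨σ, hσ, ?_, fun j hj => hn j (by simp at hj; tauto)⟩
      intro j hj
      rcases Finset.mem_insert.1 hj with rfl | hj
      · rw [hpk, hqk]
        rw [hn0] at hn'
        push_cast at hn'
        linarith
      · exact he j hj
    · have c1 : ∃ n : ℤ, σ p k - σ p k = n := ⟨0, by simp⟩
      have c2 : ¬ ∃ n : ℤ, σ q k - σ p k = n := by
        rintro ⟨n, hn'⟩
        rw [hpk, hqk] at hn'
        exact hint ⟨-n, by push_cast; linarith⟩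
      -- The class of `p` modulo `1` moves onto the coordinate of `q`, while `q`, in another class,
      -- stays fixed.
      refine ⟨_, hσ.shift k (σ p k) (σ q k - σ p k), ?_, ?_⟩
      · intro j hj
        rw [if_pos c1, if_neg c2]
        rcases eq_or_ne j k with rfl | hjk
        · simp
        · rw [Function.update_of_ne hjk]
          exact he j (by simpa [hjk] using hj)
      · intro j hj
        rw [if_pos c1, if_neg c2]
        simp only [Finset.mem_insert, not_or] at hj
        rw [Function.update_of_ne hj.1]
        exact hn j hj.2

end IsCubeTiling

/-! ### Integer-separated sets -/

section Separation

variable {d : ℕ} {T : Set (EuclideanSpace ℝ (Fin d))}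

/-- Any two distinct vectors of `T` differ by a nonzero integer in some coordinate. -/
def IsIntSeparated (T : Set (EuclideanSpace ℝ (Fin d))) : Prop :=
  ∀ s ∈ T, ∀ t ∈ T, s ≠ t → ∃ j, ∃ n : ℤ, n ≠ 0 ∧ s j - t j = n

theorem mem_unitCube_iff {x : EuclideanSpace ℝ (Fin d)} :
    x ∈ unitCube d ↔ ∀ j, 0 ≤ x j ∧ x j < 1 := Iff.rfl

theorem isTilingSet_iff :
    IsTilingSet T ↔ ∀ x : EuclideanSpace ℝ (Fin d), ∃! t : T, x - t ∈ unitCube d := by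
  refine forall_congr' fun x => ⟨?_, ?_⟩
  · rintro ⟨⟨q, t⟩, ⟨hq, ht, hx⟩, hu⟩
    refine ⟨⟨t, ht⟩, by simpa [hx] using hq, fun s hs => ?_⟩
    have := hu (x - s, s) ⟨hs, s.2, by simp⟩
    exact Subtype.ext (congrArg Prod.snd this)
  · rintro ⟨t, ht, hu⟩
    refine ⟨(x - t, t), ⟨ht, t.2, by simp⟩, ?_⟩
    rintro ⟨q, s⟩ ⟨hq, hs, hx⟩
    dsimp only at hq hs hx
    have e := hu ⟨s, hs⟩ (by simpa [hx] using hq)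
    have e' : s = t := congrArg Subtype.val e
    subst e'
    simp [hx]

theorem IsTilingSet.isIntSeparated (h : IsTilingSet T) : IsIntSeparated T := by
  have hτ : IsCubeTiling fun (t : T) j => (t : EuclideanSpace ℝ (Fin d)) j := by
    intro x
    have := isTilingSet_iff.1 h (WithLp.toLp 2 x)
    refine (existsUnique_congr fun t => ?_).1 this
    refine forall_congr' fun j => ?_
    simp only [PiLp.sub_apply]
    constructor <;> rintro ⟨h1, h2⟩ <;> constructor <;> linarith
  intro s hs t ht hst
  exact hτ.exists_int_sub (p := ⟨s, hs⟩) (q := ⟨t, ht⟩) (by simpa using hst)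

theorem IsIntSeparated.exists_one_le (h : IsIntSeparated T) {s t : EuclideanSpace ℝ (Fin d)}
    (hs : s ∈ T) (ht : t ∈ T) (hst : s ≠ t) : ∃ j, 1 ≤ |s j - t j| := by
  obtain ⟨j, n, hn, he⟩ := h s hs t ht hst
  exact ⟨j, by rw [he, ← Int.cast_abs, ← Int.cast_one, Int.cast_le]; exact Int.one_le_abs hn⟩

theorem IsIntSeparated.eq_of_mem (h : IsIntSeparated T) {s t x : EuclideanSpace ℝ (Fin d)}
    (hs : s ∈ T) (ht : t ∈ T) (hxs : x - s ∈ unitCube d) (hxt : x - t ∈ unitCube d) : s = t := by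
  by_contra hst
  obtain ⟨j, hj⟩ := h.exists_one_le hs ht hst
  have h1 := hxs j
  have h2 := hxt j
  simp only [PiLp.sub_apply] at h1 h2
  exact absurd hj (not_le.2 (abs_lt.2 ⟨by linarith, by linarith⟩))

/-- Equal floors force all coordinate differences below `1`. This yields both countability and local
finiteness of `T`. -/
theorem IsIntSeparated.injOn_floor (h : IsIntSeparated T) (x : EuclideanSpace ℝ (Fin d)) :
    Set.InjOn (fun (t : EuclideanSpace ℝ (Fin d)) j => ⌊t j - x j⌋) T := by
  intro s hs t ht hst
  by_contra hne
  obtain ⟨j, hj⟩ := h.exists_one_le hs ht hne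
  have := Int.abs_sub_lt_one_of_floor_eq_floor (congrFun hst j)
  simp only [sub_sub_sub_cancel_right] at this
  linarith

theorem IsIntSeparated.countable (h : IsIntSeparated T) : T.Countable :=
  Set.MapsTo.countable_of_injOn (Set.mapsTo_univ _ _) (h.injOn_floor 0) Set.countable_univ

/-- A point that no translate covers has a corner neighbourhood that no translate meets. -/
theorem IsIntSeparated.eventually_notMem (h : IsIntSeparated T) {x : EuclideanSpace ℝ (Fin d)}
    (hx : ∀ t ∈ T, x - t ∉ unitCube d) :
    ∀ᶠ y in 𝓝[{y | ∀ j, x j ≤ y j}] x, ∀ t ∈ T, y - t ∉ unitCube d := by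
  have hfin : {t ∈ T | ∀ j, x j - 1 ≤ t j ∧ t j < x j + 1}.Finite := by
    refine Set.Finite.of_finite_image (f := fun t j => ⌊t j - x j⌋) ?_
      ((h.injOn_floor x).mono fun t ht => ht.1)
    refine (Set.Finite.pi' fun _ : Fin d => Set.finite_Icc (-1 : ℤ) 0).subset ?_
    rintro _ ⟨t, ht, rfl⟩ j
    obtain ⟨h1, h2⟩ := ht.2 j
    refine ⟨Int.le_floor.2 (by push_cast; linarith), ?_⟩
    exact Int.lt_add_one_iff.1 (Int.floor_lt.2 (by push_cast; linarith))
  have hcont : ∀ j, Filter.Tendsto (fun y : EuclideanSpace ℝ (Fin d) => y j)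
      (𝓝[{y | ∀ j, x j ≤ y j}] x) (𝓝 (x j)) := fun j =>
    (Continuous.tendsto (by fun_prop) x).mono_left nhdsWithin_le_nhds
  have hlocal : ∀ᶠ y in 𝓝[{y | ∀ j, x j ≤ y j}] x, ∀ j, x j ≤ y j ∧ y j < x j + 1 := by
    refine Filter.eventually_all.2 fun j => ?_
    filter_upwards [self_mem_nhdsWithin, (hcont j).eventually_lt_const (lt_add_one (x j))]
      with y h1 h2 using ⟨h1 j, h2⟩
  have hnear : ∀ᶠ y in 𝓝[{y | ∀ j, x j ≤ y j}] x,
      ∀ t ∈ {t ∈ T | ∀ j, x j - 1 ≤ t j ∧ t j < x j + 1}, y - t ∉ unitCube d := by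
    refine (Filter.eventually_all_finite hfin).2 fun t ht => ?_
    have hxt := hx t ht.1
    simp only [mem_unitCube_iff, not_forall, PiLp.sub_apply, not_and_or, not_le, not_lt] at hxt
    -- Either `x j < t j`, an open condition, or `t j + 1 ≤ x j`, which persists because coordinates
    -- only increase in the corner.
    obtain ⟨j, hj | hj⟩ := hxt
    · filter_upwards [(hcont j).eventually_lt_const (show x j < t j by linarith)] with y hy hmem
      have := (hmem j).1
      simp only [PiLp.sub_apply] at this
      linarith
    · filter_upwards [self_mem_nhdsWithin] with y hy hmem
      have := (hmem j).2
      have := hy j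
      simp only [PiLp.sub_apply] at *
      linarith
  filter_upwards [hlocal, hnear] with y h1 h2 t ht hmem
  refine h2 t ⟨ht, fun j => ?_⟩ hmem
  have h3 := hmem j
  have h4 := h1 j
  simp only [PiLp.sub_apply] at h3
  constructor <;> linarith

end Separation

/-! ### Bessel and Parseval -/

section Hilbert

variable {𝕜 H ι : Type*} [RCLike 𝕜] [NormedAddCommGroup H] [InnerProductSpace 𝕜 H] {v : ι → H}

/-- **Bessel's inequality** with values in `ℝ≥0∞`. -/
theorem Orthonormal.tsum_enorm_inner_sq_le (hv : Orthonormal 𝕜 v) (x : H) :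
    ∑' i, ‖inner 𝕜 (v i) x‖ₑ ^ 2 ≤ ‖x‖ₑ ^ 2 := by
  refine ENNReal.summable.tsum_le_of_sum_le fun s => ?_
  have := ENNReal.ofReal_le_ofReal (hv.sum_inner_products_le x (s := s))
  rw [ENNReal.ofReal_sum_of_nonneg fun _ _ => by positivity] at this
  simpa only [ENNReal.ofReal_pow (norm_nonneg _), ofReal_norm] using this

/-- **Parseval's identity** with values in `ℝ≥0∞`. -/
theorem HilbertBasis.tsum_enorm_inner_sq (b : HilbertBasis ι 𝕜 H) (x : H) :
    ∑' i, ‖inner 𝕜 (b i) x‖ₑ ^ 2 = ‖x‖ₑ ^ 2 := by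
  have h := b.hasSum_inner_mul_inner x x
  have h' : HasSum (fun i => ‖inner 𝕜 (b i) x‖ ^ 2) (‖x‖ ^ 2) := by
    rw [← RCLike.hasSum_ofReal (𝕜 := 𝕜)]
    convert h using 2
    · rw [← inner_conj_symm x, RCLike.conj_mul]; push_cast; rfl
    · rw [inner_self_eq_norm_sq_to_K]; push_cast; rfl
  have := congrArg ENNReal.ofReal h'.tsum_eq
  rw [ENNReal.ofReal_tsum_of_nonneg (fun _ => by positivity) h'.summable] at this
  simpa only [ENNReal.ofReal_pow (norm_nonneg _), ofReal_norm] using this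

/-- If equality holds in Bessel's inequality for `x`, then `x` is orthogonal to every vector that is
orthogonal to the family. -/
theorem Orthonormal.inner_eq_zero_of_tsum_eq (hv : Orthonormal 𝕜 v) {x f : H}
    (hx : ∑' i, ‖inner 𝕜 (v i) x‖ₑ ^ 2 = ‖x‖ₑ ^ 2) (hf : ∀ i, inner 𝕜 (v i) f = 0) :
    inner 𝕜 f x = 0 := by
  classical
  by_contra hne
  have hf0 : f ≠ 0 := by rintro rfl; simp at hne
  have hn0 : ‖f‖ ≠ 0 := norm_ne_zero_iff.2 hf0
  -- Bessel for the family enlarged by the normalized `f` leaves no room for a nonzero coefficient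
  -- along `f`.
  have hw : Orthonormal 𝕜 fun o : Option ι => o.elim (((‖f‖⁻¹ : ℝ) : 𝕜) • f) v := by
    constructor
    · rintro (_ | i)
      · simp [norm_smul, hn0]
      · exact hv.1 i
    · rintro (_ | i) (_ | j) hij
      · exact absurd rfl hij
      · simp [inner_smul_left, inner_eq_zero_symm.1 (hf j)]
      · simp [inner_smul_right, hf i]
      · exact hv.2 (by simpa using hij)
  have hle : ‖inner 𝕜 ((((‖f‖⁻¹ : ℝ) : 𝕜)) • f) x‖ₑ ^ 2 + ∑' i, ‖inner 𝕜 (v i) x‖ₑ ^ 2 ≤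
      ‖x‖ₑ ^ 2 := by
    refine le_of_tendsto' (Filter.Tendsto.const_add _ ENNReal.summable.hasSum) fun s => ?_
    have := (ENNReal.sum_le_tsum (Finset.insertNone s)).trans (hw.tsum_enorm_inner_sq_le x)
    simpa only [Finset.sum_insertNone, Option.elim] using this
  rw [hx] at hle
  have h0 : ‖inner 𝕜 ((((‖f‖⁻¹ : ℝ) : 𝕜)) • f) x‖ₑ ^ 2 = 0 := by
    by_contra hpos
    exact absurd hle (not_le.2 (by
      rw [add_comm]
      exact ENNReal.lt_add_right (by finiteness) hpos))
  simp [inner_smul_left, hn0, hne] at h0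

end Hilbert

/-! ### Exponentials on the cube and their inner products -/

section Exponentials

variable {d : ℕ}

/-- Lebesgue measure on the half-open unit cube. -/
noncomputable abbrev cubeMeasure (d : ℕ) : Measure (EuclideanSpace ℝ (Fin d)) :=
  volume.restrict (unitCube d)

theorem unitCube_eq_preimage : unitCube d = WithLp.ofLp ⁻¹' Set.univ.pi fun _ => Set.Ico 0 1 := by
  ext x; simp [unitCube]

theorem measurableSet_unitCube : MeasurableSet (unitCube d) := by
  rw [unitCube_eq_preimage]
  exact (MeasurableSet.univ_pi fun _ => measurableSet_Ico).preimage (by fun_prop)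

theorem measurePreserving_toLp_cubeMeasure :
    MeasurePreserving (WithLp.toLp 2)
      (Measure.pi fun _ : Fin d => volume.restrict (Set.Ico (0 : ℝ) 1)) (cubeMeasure d) := by
  rw [← Measure.restrict_pi_pi]
  have := (PiLp.volume_preserving_toLp (Fin d)).restrict_preimage
    (measurableSet_unitCube (d := d))
  have he : WithLp.toLp 2 ⁻¹' unitCube d = Set.univ.pi fun _ => Set.Ico (0 : ℝ) 1 := by
    rw [unitCube_eq_preimage]; rfl
  rwa [he] at this

instance : IsProbabilityMeasure (volume.restrict (Set.Ico (0 : ℝ) 1)) := ⟨by simp⟩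

instance : IsProbabilityMeasure (cubeMeasure d) :=
  measurePreserving_toLp_cubeMeasure.map_eq ▸ Measure.isProbabilityMeasure_map
    measurePreserving_toLp_cubeMeasure.measurable.aemeasurable

theorem norm_expFun (t x : EuclideanSpace ℝ (Fin d)) : ‖expFun t x‖ = 1 := by
  rw [expFun, Complex.norm_exp]
  simp

theorem continuous_expFun (t : EuclideanSpace ℝ (Fin d)) : Continuous (expFun t) := by
  unfold expFun; fun_prop

theorem continuous_expFun_left (x : EuclideanSpace ℝ (Fin d)) :
    Continuous fun t => expFun t x := by
  unfold expFun; fun_prop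

theorem memLp_expFun (t : EuclideanSpace ℝ (Fin d)) : MemLp (expFun t) 2 (cubeMeasure d) :=
  MemLp.of_bound (continuous_expFun t).aestronglyMeasurable 1
    (.of_forall fun x => (norm_expFun t x).le)

theorem expFun_mul_conj (s t x : EuclideanSpace ℝ (Fin d)) :
    expFun t x * conj (expFun s x) = expFun (t - s) x := by
  simp only [expFun, ← Complex.exp_conj, ← Complex.exp_add, PiLp.sub_apply]
  congr 1
  simp only [map_mul, Complex.conj_ofReal, Complex.conj_I, map_ofNat, sub_mul,
    Finset.sum_sub_distrib]
  push_cast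
  ring

/-- The exponential `e_t` as an element of `L²` of the unit cube. -/
noncomputable def expLp (t : EuclideanSpace ℝ (Fin d)) : Lp ℂ 2 (cubeMeasure d) :=
  (memLp_expFun t).toLp _

theorem coeFn_expLp (t : EuclideanSpace ℝ (Fin d)) : expLp t =ᵐ[cubeMeasure d] expFun t :=
  (memLp_expFun t).coeFn_toLp

/-- The (inverse) Fourier transform of the indicator function of the unit cube. -/
noncomputable def cubeFourier (x : EuclideanSpace ℝ (Fin d)) : ℂ := ∫ y, expFun x y ∂cubeMeasure d

theorem inner_expLp_right (f : Lp ℂ 2 (cubeMeasure d)) (t : EuclideanSpace ℝ (Fin d)) :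
    inner ℂ f (expLp t) = ∫ y, expFun t y * conj (f y) ∂cubeMeasure d := by
  rw [L2.inner_def]
  refine integral_congr_ae ?_
  filter_upwards [coeFn_expLp t] with y hy
  rw [hy, RCLike.inner_apply]

theorem inner_expLp_expLp (s t : EuclideanSpace ℝ (Fin d)) :
    inner ℂ (expLp s) (expLp t) = cubeFourier (t - s) := by
  rw [inner_expLp_right]
  refine integral_congr_ae ?_
  filter_upwards [coeFn_expLp s] with y hy
  rw [hy, expFun_mul_conj]

theorem continuous_inner_expLp (f : Lp ℂ 2 (cubeMeasure d)) :
    Continuous fun t => inner ℂ f (expLp t) := by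
  simp only [inner_expLp_right]
  have hf : AEStronglyMeasurable (fun y => conj (f y)) (cubeMeasure d) :=
    Complex.continuous_conj.comp_aestronglyMeasurable (Lp.aestronglyMeasurable f)
  refine continuous_of_dominated (bound := fun y => ‖f y‖)
    (fun t => (continuous_expFun t).aestronglyMeasurable.mul hf)
    (fun t => .of_forall fun y => by simp [norm_expFun])
    ((Lp.memLp f).integrable (by norm_num)).norm
    (.of_forall fun y => (continuous_expFun_left y).mul continuous_const)

theorem continuous_cubeFourier : Continuous (cubeFourier (d := d)) := by
  simpa [inner_expLp_expLp] using continuous_inner_expLp (expLp (0 : EuclideanSpace ℝ (Fin d)))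

theorem cubeFourier_zero : cubeFourier (0 : EuclideanSpace ℝ (Fin d)) = 1 := by
  simp [cubeFourier, expFun]

theorem cubeFourier_eq_prod (x : EuclideanSpace ℝ (Fin d)) :
    cubeFourier x = ∏ j, ∫ u in (0 : ℝ)..1, Complex.exp (2 * Real.pi * Complex.I * x j * u) := by
  rw [cubeFourier, ← measurePreserving_toLp_cubeMeasure.integral_comp
    (MeasurableEquiv.toLp 2 (Fin d → ℝ)).measurableEmbedding]
  simp only [intervalIntegral.integral_of_le zero_le_one, ← integral_Ico_eq_integral_Ioc]
  rw [← integral_fintype_prod_eq_prod (𝕜 := ℂ)]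
  congr 1 with y
  rw [expFun, ← Complex.exp_sum]
  congr 1
  push_cast
  rw [Finset.mul_sum]
  exact Finset.sum_congr rfl fun j _ => by ring

theorem integral_exp_two_pi_mul_I_eq_zero_iff (a : ℝ) :
    ∫ u in (0 : ℝ)..1, Complex.exp (2 * Real.pi * Complex.I * a * u) = 0 ↔
      ∃ n : ℤ, n ≠ 0 ∧ a = n := by
  rcases eq_or_ne a 0 with rfl | ha
  · simp only [Complex.ofReal_zero, mul_zero, zero_mul, Complex.exp_zero]
    simpa using fun n hn h => hn (by exact_mod_cast h.symm)
  have hc : 2 * Real.pi * Complex.I * a ≠ 0 := by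
    simp [ha, Real.pi_ne_zero]
  rw [integral_exp_mul_complex hc, div_eq_zero_iff, or_iff_left hc, sub_eq_zero]
  simp only [Complex.ofReal_one, mul_one, Complex.ofReal_zero, mul_zero, Complex.exp_zero]
  rw [Complex.exp_eq_one_iff]
  have hpi : (2 * Real.pi * Complex.I : ℂ) ≠ 0 := by simp [Real.pi_ne_zero]
  refine exists_congr fun n => ?_
  rw [mul_comm (n : ℂ), mul_right_inj' hpi]
  norm_cast
  refine ⟨fun h => ⟨?_, h⟩, fun h => h.2⟩
  rintro rfl
  exact ha (by simpa using h)

theorem cubeFourier_eq_zero_iff (x : EuclideanSpace ℝ (Fin d)) :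
    cubeFourier x = 0 ↔ ∃ j, ∃ n : ℤ, n ≠ 0 ∧ x j = n := by
  simp [cubeFourier_eq_prod, Finset.prod_eq_zero_iff, integral_exp_two_pi_mul_I_eq_zero_iff]

theorem orthonormal_expLp_iff {T : Set (EuclideanSpace ℝ (Fin d))} :
    (Orthonormal ℂ fun t : T => expLp (t : EuclideanSpace ℝ (Fin d))) ↔ IsIntSeparated T := by
  constructor
  · intro h s hs t ht hst
    have := h.2 (i := ⟨t, ht⟩) (j := ⟨s, hs⟩) (by simpa using hst.symm)
    dsimp only at this
    rwa [inner_expLp_expLp, cubeFourier_eq_zero_iff] at this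
  · intro h
    constructor
    · intro t
      have := inner_self_eq_norm_sq (𝕜 := ℂ) (expLp (t : EuclideanSpace ℝ (Fin d)))
      rw [inner_expLp_expLp, sub_self, cubeFourier_zero, RCLike.one_re] at this
      exact (pow_eq_one_iff_of_nonneg (norm_nonneg _) two_ne_zero).1 this.symm
    · intro s t hst
      rw [inner_expLp_expLp, cubeFourier_eq_zero_iff]
      exact h t t.2 s s.2 (by simpa [Subtype.ext_iff] using hst.symm)

theorem norm_expLp (t : EuclideanSpace ℝ (Fin d)) : ‖expLp t‖ = 1 :=
  (orthonormal_expLp_iff (T := {t}).2 fun _ hs _ ht hst => absurd (hs.trans ht.symm) hst).1 ⟨t, rfl⟩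

theorem isSpectrum_iff {T : Set (EuclideanSpace ℝ (Fin d))} :
    IsSpectrum T ↔ ∃ b : HilbertBasis T ℂ (Lp ℂ 2 (cubeMeasure d)), ∀ t : T, b t = expLp t.1 := by
  refine exists_congr fun b => forall_congr' fun t => ?_
  exact ⟨fun h => Lp.ext (h.trans (coeFn_expLp _).symm), fun h => h ▸ coeFn_expLp _⟩

theorem IsSpectrum.isIntSeparated {T : Set (EuclideanSpace ℝ (Fin d))} (h : IsSpectrum T) :
    IsIntSeparated T := by
  obtain ⟨b, hb⟩ := isSpectrum_iff.1 h
  exact orthonormal_expLp_iff.1 (funext hb ▸ b.orthonormal)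

theorem IsIntSeparated.isSpectrum {T : Set (EuclideanSpace ℝ (Fin d))} (h : IsIntSeparated T)
    (hT : ∀ f : Lp ℂ 2 (cubeMeasure d), (∀ t ∈ T, inner ℂ (expLp t) f = 0) → f = 0) :
    IsSpectrum T := by
  have ho := orthonormal_expLp_iff.2 h
  refine isSpectrum_iff.2 ⟨HilbertBasis.mkOfOrthogonalEqBot ho ?_,
    fun t => by rw [HilbertBasis.coe_mkOfOrthogonalEqBot]⟩
  rw [Submodule.eq_bot_iff]
  intro f hf
  refine hT f fun t ht => ?_
  exact (Submodule.mem_orthogonal _ _).1 hf _ (Submodule.subset_span ⟨⟨t, ht⟩, rfl⟩)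

end Exponentials

/-! ### Transfer along measure-preserving maps -/

section MeasurePreserving

variable {α β E : Type*} [MeasurableSpace α] [MeasurableSpace β] {μ : Measure α} {ν : Measure β}
  {g : α → β}

theorem MeasureTheory.MeasurePreserving.integral_comp_of_aestronglyMeasurable
    [NormedAddCommGroup E] [NormedSpace ℝ E] (hg : MeasurePreserving g μ ν) {f : β → E}
    (hf : AEStronglyMeasurable f ν) : ∫ x, f (g x) ∂μ = ∫ y, f y ∂ν := by
  obtain ⟨hm, rfl⟩ := hg
  exact (integral_map hm.aemeasurable hf).symm

theorem MeasureTheory.MeasurePreserving.ae_of_ae_comp (hg : MeasurePreserving g μ ν) {p : β → Prop}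
    (hp : MeasurableSet {y | p y}) (h : ∀ᵐ x ∂μ, p (g x)) : ∀ᵐ y ∂ν, p y := by
  obtain ⟨hm, rfl⟩ := hg
  exact (ae_map_iff hm.aemeasurable hp).2 h

end MeasurePreserving

/-! ### Completeness of the integer exponentials -/

section Lattice

variable {d : ℕ}

/-- The integer lattice `ℤ^d`. -/
def intLattice (d : ℕ) : Set (EuclideanSpace ℝ (Fin d)) := {x | ∀ j, ∃ n : ℤ, x j = n}

theorem isIntSeparated_intLattice : IsIntSeparated (intLattice d) := by
  intro s hs t ht hst
  obtain ⟨j, hj⟩ : ∃ j, s j ≠ t j := by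
    by_contra! h
    exact hst (PiLp.ext h)
  obtain ⟨m, hm⟩ := hs j
  obtain ⟨n, hn⟩ := ht j
  refine ⟨j, m - n, ?_, by rw [hm, hn]; push_cast; rfl⟩
  rintro h
  rw [sub_eq_zero] at h
  exact hj (by rw [hm, hn, h])

theorem exists_mem_intLattice_sub_mem_unitCube (x : EuclideanSpace ℝ (Fin d)) :
    ∃ t ∈ intLattice d, x - t ∈ unitCube d := by
  refine ⟨WithLp.toLp 2 fun j => (⌊x j⌋ : ℝ), fun j => ⟨⌊x j⌋, rfl⟩, fun j => ?_⟩
  exact ⟨Int.fract_nonneg (x j), Int.fract_lt_one (x j)⟩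

/-- The section of the quotient map onto the torus with values in the half-open unit cube. -/
noncomputable def torusToCube (θ : UnitAddTorus (Fin d)) : EuclideanSpace ℝ (Fin d) :=
  WithLp.toLp 2 fun j => (AddCircle.equivIco 1 0 (θ j) : ℝ)

theorem measurePreserving_equivIco :
    MeasurePreserving (fun θ : UnitAddCircle => (AddCircle.equivIco 1 0 θ : ℝ))
      AddCircle.haarAddCircle (volume.restrict (Set.Ico (0 : ℝ) 1)) := by
  have hm : Measurable fun θ : UnitAddCircle => (AddCircle.equivIco 1 0 θ : ℝ) :=
    measurable_subtype_coe.comp (AddCircle.measurableEquivIco 1 0).measurable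
  have hmk := AddCircle.measurePreserving_mk 1 0
  have hv : (volume : Measure UnitAddCircle) = AddCircle.haarAddCircle := by
    rw [AddCircle.volume_eq_smul_haarAddCircle]; simp
  rw [zero_add, ← restrict_Ico_eq_restrict_Ioc, hv] at hmk
  refine ⟨hm, ?_⟩
  rw [← hmk.map_eq, Measure.map_map hm hmk.measurable]
  conv_rhs => rw [← Measure.map_id (μ := volume.restrict (Set.Ico (0 : ℝ) 1))]
  refine Measure.map_congr ?_
  filter_upwards [ae_restrict_mem measurableSet_Ico] with u hu
  simp only [Function.comp, id]
  rw [AddCircle.equivIco_coe_eq (by simpa using hu)]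

theorem measurePreserving_torusToCube :
    MeasurePreserving (torusToCube (d := d)) (Measure.pi fun _ => AddCircle.haarAddCircle)
      (cubeMeasure d) :=
  measurePreserving_toLp_cubeMeasure.comp
    (measurePreserving_pi _ _ fun _ => measurePreserving_equivIco)

theorem mFourier_eq_expFun (n : Fin d → ℤ) (θ : UnitAddTorus (Fin d)) :
    UnitAddTorus.mFourier n θ =
      expFun (WithLp.toLp 2 fun j => (n j : ℝ)) (torusToCube θ) := by
  rw [expFun, Complex.ofReal_sum, Finset.mul_sum, Complex.exp_sum]
  change ∏ j, fourier (n j) (θ j) = _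
  refine Finset.prod_congr rfl fun j _ => ?_
  have h : θ j = ((AddCircle.equivIco 1 0 (θ j) : ℝ) : UnitAddCircle) :=
    ((AddCircle.equivIco 1 0).symm_apply_apply (θ j)).symm
  conv_lhs => rw [h]
  rw [fourier_coe_apply]
  congr 1
  simp only [torusToCube]
  push_cast
  ring

/-- Pulled back to the torus, `f` has zero coefficients in the Hilbert basis `mFourierBasis`. -/
theorem eq_zero_of_inner_expLp_intLattice_eq_zero {f : Lp ℂ 2 (cubeMeasure d)}
    (hf : ∀ t ∈ intLattice d, inner ℂ (expLp t) f = 0) : f = 0 := by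
  -- This makes `volume` on the torus the product of the Haar probability measures, as
  -- `mFourierBasis` requires.
  let : MeasureSpace UnitAddCircle := ⟨AddCircle.haarAddCircle⟩
  have hp := measurePreserving_torusToCube (d := d)
  have hF : MemLp (f ∘ torusToCube) 2 (volume : Measure (UnitAddTorus (Fin d))) :=
    (Lp.memLp f).comp_measurePreserving hp
  have h0 : hF.toLp = 0 := by
    refine UnitAddTorus.mFourierBasis.repr.injective (lp.ext (funext fun n => ?_))
    rw [UnitAddTorus.mFourierBasis_repr, map_zero]
    have h1 := hf (WithLp.toLp 2 fun j => (n j : ℝ)) fun j => ⟨n j, rfl⟩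
    rw [L2.inner_def, ← hp.integral_comp_of_aestronglyMeasurable
      (L2.integrable_inner (𝕜 := ℂ) _ _).aestronglyMeasurable] at h1
    refine Eq.trans (integral_congr_ae ?_) h1
    filter_upwards [hF.coeFn_toLp, hp.quasiMeasurePreserving.ae (coeFn_expLp _)] with θ h2 h3
    rw [h2, h3, UnitAddTorus.mFourier_neg, mFourier_eq_expFun, smul_eq_mul, RCLike.inner_apply,
      mul_comm, Function.comp_apply]
  have h1 : f ∘ torusToCube =ᵐ[volume] 0 :=
    hF.coeFn_toLp.symm.trans (h0 ▸ Lp.coeFn_zero _ _ _)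
  refine Lp.ext (Filter.EventuallyEq.trans ?_ (Lp.coeFn_zero _ _ _).symm)
  exact hp.ae_of_ae_comp
    (measurableSet_eq_fun (Lp.stronglyMeasurable f).measurable measurable_const) h1

theorem isSpectrum_intLattice : IsSpectrum (intLattice d) :=
  isIntSeparated_intLattice.isSpectrum fun _ => eq_zero_of_inner_expLp_intLattice_eq_zero

end Lattice

/-! ### Spectra and tilings -/

section Tiling

variable {d : ℕ} {T : Set (EuclideanSpace ℝ (Fin d))}

/-- The union of the translates of the unit cube by the vectors of `T`. -/
def cubeUnion (T : Set (EuclideanSpace ℝ (Fin d))) : Set (EuclideanSpace ℝ (Fin d)) :=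
  ⋃ t : T, {x | x - t ∈ unitCube d}

theorem mem_cubeUnion {x : EuclideanSpace ℝ (Fin d)} :
    x ∈ cubeUnion T ↔ ∃ t ∈ T, x - t ∈ unitCube d := by
  simp [cubeUnion]

theorem isTilingSet_iff_cubeUnion_eq_univ (h : IsIntSeparated T) :
    IsTilingSet T ↔ cubeUnion T = Set.univ := by
  rw [isTilingSet_iff, Set.eq_univ_iff_forall]
  refine forall_congr' fun x => ?_
  rw [mem_cubeUnion]
  constructor
  · rintro ⟨t, ht, -⟩
    exact ⟨t, t.2, ht⟩
  · rintro ⟨t, ht, hx⟩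
    exact ⟨⟨t, ht⟩, hx, fun s hs => Subtype.ext (h.eq_of_mem s.2 ht hs hx)⟩

theorem measurableSet_setOf_sub_mem_unitCube (t : EuclideanSpace ℝ (Fin d)) :
    MeasurableSet {x | x - t ∈ unitCube d} :=
  measurableSet_unitCube.preimage (measurable_id.sub_const t)

theorem IsIntSeparated.measurableSet_cubeUnion (h : IsIntSeparated T) :
    MeasurableSet (cubeUnion T) := by
  have := h.countable.to_subtype
  exact MeasurableSet.iUnion fun t => measurableSet_setOf_sub_mem_unitCube _

theorem measurable_comp_add_right {f : EuclideanSpace ℝ (Fin d) → ℝ≥0∞} (hf : Measurable f)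
    (y : EuclideanSpace ℝ (Fin d)) : Measurable fun x => f (x + y) :=
  hf.comp (measurable_add_const y)

/-- Unfolding: separation makes the translates of the cube disjoint, and there are countably many.
-/
theorem IsIntSeparated.lintegral_tsum (h : IsIntSeparated T)
    {f : EuclideanSpace ℝ (Fin d) → ℝ≥0∞} (hf : Measurable f) :
    ∫⁻ x, ∑' t : T, f (x + t) ∂cubeMeasure d = ∫⁻ z in cubeUnion T, f z := by
  have := h.countable.to_subtype
  rw [MeasureTheory.lintegral_tsum fun t : T => (measurable_comp_add_right hf t.1).aemeasurable,
    cubeUnion, lintegral_iUnion (fun t => measurableSet_setOf_sub_mem_unitCube _)]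
  · refine tsum_congr fun t => ?_
    have := (measurePreserving_add_right volume
      (t : EuclideanSpace ℝ (Fin d))).setLIntegral_comp_preimage
      (measurableSet_setOf_sub_mem_unitCube t.1) hf
    rw [← this]
    simp
  · intro s t hst
    refine Set.disjoint_left.2 fun x hs ht => hst (Subtype.ext (h.eq_of_mem s.2 t.2 hs ht))

/-- The squared modulus of the Fourier transform of the unit cube. -/
noncomputable def cubePower (x : EuclideanSpace ℝ (Fin d)) : ℝ≥0∞ := ‖cubeFourier x‖ₑ ^ 2

theorem measurable_cubePower : Measurable (cubePower (d := d)) :=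
  (continuous_cubeFourier.measurable.enorm).pow_const 2

/-- Turns `∑ cubePower (x + t)` into the Bessel sum of the unit vector `e_{-x}`. -/
theorem cubePower_eq (x t : EuclideanSpace ℝ (Fin d)) :
    cubePower (x + t) = ‖inner ℂ (expLp t) (expLp (-x))‖ₑ ^ 2 := by
  rw [← ofReal_norm (inner ℂ (expLp t) (expLp (-x))), norm_inner_symm, ofReal_norm,
    inner_expLp_expLp, cubePower, sub_neg_eq_add, add_comm]

theorem enorm_expLp (t : EuclideanSpace ℝ (Fin d)) : ‖expLp t‖ₑ = 1 := by
  rw [← ofReal_norm, norm_expLp, ENNReal.ofReal_one]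

theorem IsIntSeparated.tsum_cubePower_le (h : IsIntSeparated T) (x : EuclideanSpace ℝ (Fin d)) :
    ∑' t : T, cubePower (x + t.1) ≤ 1 := by
  simpa only [cubePower_eq, enorm_expLp, one_pow] using
    (orthonormal_expLp_iff.2 h).tsum_enorm_inner_sq_le (expLp (-x))

theorem IsSpectrum.tsum_cubePower (h : IsSpectrum T) (x : EuclideanSpace ℝ (Fin d)) :
    ∑' t : T, cubePower (x + t.1) = 1 := by
  obtain ⟨b, hb⟩ := isSpectrum_iff.1 h
  simpa only [cubePower_eq, enorm_expLp, one_pow, hb] using b.tsum_enorm_inner_sq (expLp (-x))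

theorem IsSpectrum.setLIntegral_cubePower (h : IsSpectrum T) (y : EuclideanSpace ℝ (Fin d)) :
    ∫⁻ z in cubeUnion T, cubePower (z + y) = 1 := by
  rw [← h.isIntSeparated.lintegral_tsum (measurable_comp_add_right measurable_cubePower y)]
  simp only [add_right_comm, h.tsum_cubePower, lintegral_const, measure_univ, mul_one]

theorem cubeUnion_intLattice : cubeUnion (intLattice d) = Set.univ :=
  Set.eq_univ_iff_forall.2 fun x =>
    mem_cubeUnion.2 (exists_mem_intLattice_sub_mem_unitCube x)

theorem lintegral_cubePower_add (y : EuclideanSpace ℝ (Fin d)) :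
    ∫⁻ z, cubePower (z + y) = 1 := by
  simpa [cubeUnion_intLattice] using (isSpectrum_intLattice (d := d)).setLIntegral_cubePower y

/-- A spectrum of the unit cube is a tiling set. -/
theorem IsSpectrum.isTilingSet (h : IsSpectrum T) : IsTilingSet T := by
  have hs := h.isIntSeparated
  rw [isTilingSet_iff_cubeUnion_eq_univ hs, Set.eq_univ_iff_forall]
  intro x
  by_contra hx
  have hcompl : ∫⁻ z in (cubeUnion T)ᶜ, cubePower (z + -x) = 0 := by
    have := lintegral_add_compl (μ := volume) (fun z => cubePower (z + -x))
      hs.measurableSet_cubeUnion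
    rw [h.setLIntegral_cubePower, lintegral_cubePower_add] at this
    exact (ENNReal.add_right_inj ENNReal.one_ne_top).1 (this.trans (add_zero 1).symm)
  rw [lintegral_eq_zero_iff (measurable_comp_add_right measurable_cubePower _),
    Filter.EventuallyEq, ae_restrict_iff' hs.measurableSet_cubeUnion.compl] at hcompl
  have hunc := hs.eventually_notMem (x := x) fun t ht hm => hx (mem_cubeUnion.2 ⟨t, ht, hm⟩)
  have hpos : ∀ᶠ y in 𝓝 x, cubeFourier (y + -x) ≠ 0 := by
    have hc : Continuous fun y => cubeFourier (y + -x) :=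
      continuous_cubeFourier.comp (continuous_add_const _)
    refine hc.continuousAt.eventually_ne ?_
    rw [add_neg_cancel, cubeFourier_zero]
    exact one_ne_zero
  obtain ⟨V, hV, hVo, hxV⟩ := eventually_nhds_iff.1 ((eventually_nhdsWithin_iff.1 hunc).and hpos)
  -- The closed corner at `x` need not be open, so its strict part supplies the open set of positive
  -- measure.
  have hWo : IsOpen (V ∩ ⋂ j, {y : EuclideanSpace ℝ (Fin d) | x j < y j}) :=
    hVo.inter (isOpen_iInter_of_finite fun j => isOpen_lt continuous_const (by fun_prop))
  have hWn : (V ∩ ⋂ j, {y : EuclideanSpace ℝ (Fin d) | x j < y j}).Nonempty := by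
    have hc : Continuous fun ε : ℝ => x + ε • (WithLp.toLp 2 fun _ => (1 : ℝ)) := by fun_prop
    have hm : ∀ᶠ ε in 𝓝[>] (0 : ℝ), x + ε • (WithLp.toLp 2 fun _ => (1 : ℝ)) ∈ V :=
      (hc.tendsto 0).mono_left nhdsWithin_le_nhds (hVo.mem_nhds (by simpa using hxV))
    obtain ⟨ε, hε, hε0⟩ := (hm.and self_mem_nhdsWithin).exists
    exact ⟨_, hε, Set.mem_iInter.2 fun j => by simpa using hε0⟩
  refine (hWo.measure_pos volume hWn).ne' (measure_mono_null ?_ hcompl)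
  rintro y ⟨hyV, hy⟩ hy0
  obtain ⟨h1, h2⟩ := hV y hyV
  have h3 := h1 fun j => (Set.mem_iInter.1 hy j).le
  refine h2 ?_
  simpa [cubePower] using hy0 fun hm => by
    obtain ⟨t, ht, hyt⟩ := mem_cubeUnion.1 hm
    exact h3 t ht hyt

/-- A tiling set of the unit cube is a spectrum. -/
theorem IsTilingSet.isSpectrum (h : IsTilingSet T) : IsSpectrum T := by
  have hs := h.isIntSeparated
  have hU := (isTilingSet_iff_cubeUnion_eq_univ hs).1 h
  have := hs.countable.to_subtype
  have hSm : Measurable fun x => ∑' t : T, cubePower (x + t.1) :=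
    Measurable.tsum fun t => measurable_comp_add_right measurable_cubePower t.1
  -- The Bessel defect is nonnegative with zero integral over every translate of the cube; summing
  -- over `ℤ^d` below makes it vanish almost everywhere.
  have hdef : ∀ y : EuclideanSpace ℝ (Fin d),
      ∫⁻ x, (1 - ∑' t : T, cubePower (x + y + t.1)) ∂cubeMeasure d = 0 := by
    intro y
    have hy : ∫⁻ x, ∑' t : T, cubePower (x + y + t.1) ∂cubeMeasure d = 1 := by
      have := hs.lintegral_tsum (measurable_comp_add_right measurable_cubePower y)
      simp only [hU, Measure.restrict_univ, lintegral_cubePower_add] at this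
      simpa only [add_right_comm] using this
    rw [lintegral_sub (measurable_comp_add_right hSm y) (by rw [hy]; simp)
      (.of_forall fun x => hs.tsum_cubePower_le _), hy]
    simp
  have hae : ∀ᵐ x : EuclideanSpace ℝ (Fin d), ∑' t : T, cubePower (x + t.1) = 1 := by
    have hm : Measurable fun x => 1 - ∑' t : T, cubePower (x + t.1) := measurable_const.sub hSm
    have h0 := (isIntSeparated_intLattice (d := d)).lintegral_tsum hm
    have := (isIntSeparated_intLattice (d := d)).countable.to_subtype
    rw [MeasureTheory.lintegral_tsum fun n : intLattice d =>
        (measurable_comp_add_right hm n.1).aemeasurable,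
      cubeUnion_intLattice, Measure.restrict_univ] at h0
    simp only [hdef, tsum_zero] at h0
    filter_upwards [(lintegral_eq_zero_iff hm).1 h0.symm] with x hx
    exact le_antisymm (hs.tsum_cubePower_le x) (tsub_eq_zero_iff_le.1 hx)
  refine hs.isSpectrum fun f hf => eq_zero_of_inner_expLp_intLattice_eq_zero fun n _ => ?_
  have hc : Continuous fun x => inner ℂ f (expLp (-x)) :=
    (continuous_inner_expLp f).comp continuous_neg
  have hz : (fun x => inner ℂ f (expLp (-x))) =ᵐ[volume] fun _ => 0 := by
    filter_upwards [hae] with x hx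
    refine (orthonormal_expLp_iff.2 hs).inner_eq_zero_of_tsum_eq ?_ fun t => hf t t.2
    simpa only [cubePower_eq, enorm_expLp, one_pow] using hx
  -- Continuous functions equal almost everywhere agree everywhere, in particular on the null set
  -- `ℤ^d`.
  have := congrFun ((hc.ae_eq_iff_eq volume continuous_const).1 hz) (-n)
  rw [neg_neg] at this
  exact inner_eq_zero_symm.1 this

end Tiling

theorem theorem1p1 (d : ℕ) (T : Set (EuclideanSpace ℝ (Fin d))) :
    IsSpectrum T ↔ IsTilingSet T :=
  ⟨IsSpectrum.isTilingSet, IsTilingSet.isSpectrum⟩
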